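/- Fix finite disjoint sets $M_1, M_2$ of modal operators. For a finite set $M$ of modal operators $\Box$, let $\mathcal{L}^=_M$ be the one-variable first-order modal language with countably many unary predicate letters $P$, constants $c_1, c_2, \dots$, equality, $\neg$, $\wedge$, the quantifier $\exists x$ and the operators in $M$; its atoms are $P(t)$ and $t_1 = t_2$, where a term is the variable $x$ or a constant. An $M$-frame consists of a non-empty set $W$ of worlds and a relation $R_\Box \subseteq W \times W$ for each $\Box \in M$; it is non-trivial if $w R_\Box v$ for some $\Box \in M$ and some distinct $w, v \in W$. A constant-domain model based on a frame assigns to all worlds the same domain $\Delta \neq \emptyset$, and to each world an interpretation of the predicate letters as subsets of $\Delta$ and of the constants as elements of $\Delta$; the interpretation of a constant may vary from world to world, and $=$ is interpreted as identity. A formula is true in a model if it is true at every world under every assignment of an element of $\Delta$ to $x$. For classes $\mathcal{C}_1$ and $\mathcal{C}_2$ of $M_1$-frames and $M_2$-frames, $\mathcal{C}_1 \otimes \mathcal{C}_2$ is the class of all $(M_1 \cup M_2)$-frames $(W, (R_\Box)_{\Box \in M_1 \cup M_2})$ with $(W, (R_\Box)_{\Box \in M_1}) \in \mathcal{C}_1$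 and $(W, (R_\Box)_{\Box \in M_2}) \in \mathcal{C}_2$. For a class $\mathcal{C}$ of $M$-frames, $\mathrm{Log}^=_{cd}(\mathcal{C})$ is the set of all $\mathcal{L}^=_M$-formulas that are true in every constant-domain model based on a frame in $\mathcal{C}$. A formula $\psi$ is a global consequence of $\varphi$ in a set $L$ of formulas if $\psi$ belongs to the smallest set that includes $L \cup \{\varphi\}$ and is closed under modus ponens, generalisation ($\chi / \forall x\, \chi$) and necessitation ($\chi / \Box \chi$ for every operator $\Box$). **Theorem.** Let $\mathcal{C}_1$ be a class of $M_1$-frames and $\mathcal{C}_2$ a class of $M_2$-frames, each closed under isomorphic copies and under disjoint unions of non-empty families, and each containing a non-trivial frame. Then the global consequence in $\mathrm{Log}^=_{cd}(\mathcal{C}_1 \otimes \mathcal{C}_2)$ is undecidable: there is no algorithm that decides, given formulas $\varphi$ and $\psi$, whether $\psi$ is a global consequence of $\varphi$ in $\mathrm{Log}^=_{cd}(\mathcal{C}_1 \otimes \mathcal{C}_2)$. Likewise, there is no algorithm that decides, given $\varphi$ and $\psi$, whether $\psi$ is true in every constant-domain model that is based on a frame in $\mathcal{C}_1 \otimes \mathcal{C}_2$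 and in which $\varphi$ is true. -/

import Mathlib

universe u v w

namespace OneVarModal

/-- Terms of the one-variable language with equality: the variable `x` or a constant `c_k`. -/
inductive Term : Type
  | x : Term
  | const (k : ℕ) : Term

/-- Formulas of the one-variable first-order modal language with equality and constants,
with one necessity operator for each element of `M`. There are countably many unary
predicate letters, and the only quantified variable is `x`. -/
inductive Formula (M : Type v) : Type v
  | pred (P : ℕ) (t : Term) : Formula M
  | eq (s t : Term) : Formula M
  | neg (φ : Formula M) : Formula M
  | and (φ ψ : Formula M) : Formula M
  | ex (φ : Formula M) : Formula M
  | box (m : M) (φ : Formula M) : Formula M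

namespace Formula

variable {M : Type v}

/-- Implication, as an abbreviation. -/
def imp (φ ψ : Formula M) : Formula M := neg (and φ (neg ψ))

/-- The universal quantifier, as an abbreviation. -/
def all (φ : Formula M) : Formula M := neg (ex (neg φ))

end Formula

/-- Kripke frames with one accessibility relation for each element of `M`
and a non-empty set of worlds. -/
structure Frame (M : Type v) : Type (max v (u + 1)) where
  W : Type u
  nonempty : Nonempty W
  R : M → W → W → Prop

namespace Frame

variable {M : Type v}

/-- There are distinct worlds one of which sees the other. -/
def NonTrivial (F : Frame.{u} M) : Prop :=
  ∃ a b : F.W, a ≠ b ∧ ∃ m, F.R m a b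

/-- Isomorphism of frames. -/
def Iso (F G : Frame.{u} M) : Prop :=
  ∃ e : F.W ≃ G.W, ∀ m a b, F.R m a b ↔ G.R m (e a) (e b)

/-- The disjoint union of a non-empty family of frames. -/
def disjointUnion {ι : Type u} [hι : Nonempty ι] (F : ι → Frame.{u} M) : Frame.{u} M where
  W := Σ i, (F i).W
  nonempty := hι.elim fun i => (F i).nonempty.elim fun a => ⟨⟨i, a⟩⟩
  R m p q := ∃ (i : ι) (a b : (F i).W), p = ⟨i, a⟩ ∧ q = ⟨i, b⟩ ∧ (F i).R m a b

end Frame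

/-- A class of frames contains every isomorphic copy of each of its members. -/
def ClosedUnderIso {M : Type v} (C : Set (Frame.{u} M)) : Prop :=
  ∀ F ∈ C, ∀ G : Frame.{u} M, F.Iso G → G ∈ C

/-- A class of frames contains the disjoint union of every non-empty family of its members. -/
def ClosedUnderDisjointUnions {M : Type v} (C : Set (Frame.{u} M)) : Prop :=
  ∀ (ι : Type u) [Nonempty ι] (F : ι → Frame.{u} M),
    (∀ i, F i ∈ C) → Frame.disjointUnion F ∈ C

/-- The class of all fusions of a frame in `C₁` and a frame in `C₂` with the same set of
worlds. The two (disjoint) sets of modal operators are put together as a sum type. -/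
def fusion {M₁ : Type v} {M₂ : Type w} (C₁ : Set (Frame.{u} M₁)) (C₂ : Set (Frame.{u} M₂)) :
    Set (Frame.{u} (M₁ ⊕ M₂)) :=
  {F | ∃ (W : Type u) (h : Nonempty W) (R₁ : M₁ → W → W → Prop) (R₂ : M₂ → W → W → Prop),
    (⟨W, h, R₁⟩ : Frame.{u} M₁) ∈ C₁ ∧ (⟨W, h, R₂⟩ : Frame.{u} M₂) ∈ C₂ ∧
      F = ⟨W, h, Sum.elim R₁ R₂⟩}

/-- Constant-domain models with equality based on a frame. Constants are not assumed to be
rigid: their values may vary from world to world. The domain is automatically non-empty. -/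
structure CDModel {M : Type v} (F : Frame.{u} M) : Type (u + 1) where
  Dom : Type u
  pred : F.W → ℕ → Set Dom
  const : F.W → ℕ → Dom

namespace CDModel

variable {M : Type v} {F : Frame.{u} M}

/-- The value of a term at a world, where `a` is the element assigned to `x`. -/
def val (𝔐 : CDModel F) (s : F.W) (a : 𝔐.Dom) : Term → 𝔐.Dom
  | .x => a
  | .const k => 𝔐.const s k

/-- Truth of a formula at a world, where `a` is the element assigned to `x`. -/
def Sat (𝔐 : CDModel F) : F.W → 𝔐.Dom → Formula M → Prop
  | s, a, .pred P t => 𝔐.val s a t ∈ 𝔐.pred s P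
  | s, a, .eq t₁ t₂ => 𝔐.val s a t₁ = 𝔐.val s a t₂
  | s, a, .neg φ => ¬ 𝔐.Sat s a φ
  | s, a, .and φ ψ => 𝔐.Sat s a φ ∧ 𝔐.Sat s a ψ
  | s, _, .ex φ => ∃ b, 𝔐.Sat s b φ
  | s, a, .box m φ => ∀ s', F.R m s s' → 𝔐.Sat s' a φ

/-- Truth in a model: truth at all worlds under all assignments. -/
def Models (𝔐 : CDModel F) (φ : Formula M) : Prop :=
  ∀ s a, 𝔐.Sat s a φ

end CDModel

/-- The set of formulas that are true in all constant-domain models with equality that are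
based on a frame in `C`. -/
def LogCDEq {M : Type v} (C : Set (Frame.{u} M)) : Set (Formula M) :=
  {φ | ∀ F ∈ C, ∀ 𝔐 : CDModel F, 𝔐.Models φ}

/-- Global consequence in `L`: the formula `ψ` belongs to the smallest set that includes
`L ∪ {φ}` and is closed under modus ponens, generalisation and necessitation. -/
inductive GlobalConsequence {M : Type v} (L : Set (Formula M)) (φ : Formula M) :
    Formula M → Prop
  | ax {χ : Formula M} : χ ∈ L → GlobalConsequence L φ χ
  | premise : GlobalConsequence L φ φ
  | mp {χ θ : Formula M} : GlobalConsequence L φ (χ.imp θ) → GlobalConsequence L φ χ →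
      GlobalConsequence L φ θ
  | gen {χ : Formula M} : GlobalConsequence L φ χ → GlobalConsequence L φ χ.all
  | nec {χ : Formula M} (m : M) : GlobalConsequence L φ χ → GlobalConsequence L φ (.box m χ)

/-- Semantic global consequence over a class of frames: every constant-domain model with
equality that is based on a frame in `C` and in which `φ` is true also makes `ψ` true. -/
def SemanticGlobalConsequence {M : Type v} (C : Set (Frame.{u} M)) (φ ψ : Formula M) : Prop :=
  ∀ F ∈ C, ∀ 𝔐 : CDModel F, 𝔐.Models φ → 𝔐.Models ψ

/-- Gödel numbers of terms. -/
def Term.code : Term → ℕ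
  | .x => 0
  | .const k => k + 1

/-- Gödel numbers of formulas. The numbering of the modal operators is immaterial when there
are only finitely many of them. -/
def Formula.code {M : Type v} [Encodable M] : Formula M → ℕ
  | .pred P t => Nat.pair 0 (Nat.pair P t.code)
  | .eq s t => Nat.pair 1 (Nat.pair s.code t.code)
  | .neg φ => Nat.pair 2 φ.code
  | .and φ ψ => Nat.pair 3 (Nat.pair φ.code ψ.code)
  | .ex φ => Nat.pair 4 φ.code
  | .box m φ => Nat.pair 5 (Nat.pair (Encodable.encode m) φ.code)

theorem Term.code_injective : Function.Injective Term.code := by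
  intro s t h
  cases s <;> cases t <;> simp_all [Term.code]

theorem Formula.code_injective {M : Type v} [Encodable M] :
    Function.Injective (Formula.code : Formula M → ℕ) := by
  intro φ
  induction φ with
  | pred P t =>
    intro ψ h
    cases ψ <;> simp [Formula.code, Nat.pair_eq_pair] at h
    simp [h.1, Term.code_injective h.2]
  | eq s t =>
    intro ψ h
    cases ψ <;> simp [Formula.code, Nat.pair_eq_pair] at h
    simp [Term.code_injective h.1, Term.code_injective h.2]
  | neg φ ih =>
    intro ψ h
    cases ψ <;> simp [Formula.code, Nat.pair_eq_pair] at h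
    simp [ih h]
  | and φ χ ih₁ ih₂ =>
    intro ψ h
    cases ψ <;> simp [Formula.code, Nat.pair_eq_pair] at h
    simp [ih₁ h.1, ih₂ h.2]
  | ex φ ih =>
    intro ψ h
    cases ψ <;> simp [Formula.code, Nat.pair_eq_pair] at h
    simp [ih h]
  | box m φ ih =>
    intro ψ h
    cases ψ <;> simp [Formula.code, Nat.pair_eq_pair] at h
    simp [h.1, ih h.2]

/-- A binary relation between formulas is decidable: the set of pairs of Gödel numbers of
related formulas is recursive. -/
def DecidableRelation {M : Type v} [Encodable M] (r : Formula M → Formula M → Prop) : Prop :=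
  ComputablePred fun n : ℕ × ℕ => ∃ φ ψ : Formula M, n = (φ.code, ψ.code) ∧ r φ ψ

end OneVarModal

/-! The halting problem of one fixed counter machine (`exists_undecidable_program`) is reduced to
both relations. A world represents a configuration: the size of a predicate is the value of a
register, and the non-rigid constant `c₀` names the one element that enters or leaves a register in
the next step. Since the domain is constant, `x` free under a box compares the contents of a
register before and after a step. Successive worlds are joined alternately by an operator from `M₁`
and one from `M₂`, and labels record which comes next. A step only concerns successors whose label
has the opposite direction, so loops and backward edges do no harm.

If the run with input `n` halts, finitely many necessitations of `program` exclude the initial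
configuration, because a stopped label is declared contradictory. So `neg (input B n)` is derivable
(`globalConsequence_of_halts`), and by soundness it is a semantic consequence. If the run is
infinite, a model on an infinite alternating path refutes the semantic consequence
(`exists_halts_of_semanticGlobalConsequence`). Halting, derivability and semantic consequence are
thus equivalent; no completeness theorem is needed.

The path (`exists_alternating_path`) needs just one proper edge in each class: many copies of the
first frame provide the even edges, many copies of the second the odd ones, and a bijection between
the two sets of worlds links them into a chain. -/

namespace CounterMachine

/-! ### Counter machines and relocatable program fragments -/

/-- Instructions of a counter machine: `inc r t` increments register `r` and goes to label `t`;
`dec r t u` goes to label `u` if register `r` is zero, and otherwise decrements it and goes to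
label `t`. -/
inductive Instr : Type
  | inc (r t : ℕ) : Instr
  | dec (r t u : ℕ) : Instr

/-- A program assigns an instruction, or a stop, to every label. -/
abbrev Program := ℕ → Option Instr

/-- The current label and the values of the registers. -/
abbrev Config := ℕ × (ℕ → ℕ)

/-- The effect of an instruction. -/
def Instr.exec : Instr → (ℕ → ℕ) → Config
  | inc r t, σ => (t, Function.update σ r (σ r + 1))
  | dec r t u, σ => if σ r = 0 then (u, σ) else (t, Function.update σ r (σ r - 1))

/-- The value of a register that is about to be incremented, or its value after it has been
decremented. -/
def Instr.index : Instr → (ℕ → ℕ) → ℕ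
  | .inc r _, σ => σ r
  | .dec r _ _, σ => σ r - 1

/-- One step of a run; a stopped configuration does not change. -/
def step (P : Program) (c : Config) : Config :=
  (P c.1).elim c fun i => i.exec c.2

/-- The second configuration is reached from the first in at least one step. -/
def Reaches (P : Program) (c d : Config) : Prop :=
  ∃ n, 0 < n ∧ (step P)^[n] c = d

theorem Reaches.trans {P : Program} {c d e : Config} (h₁ : Reaches P c d) (h₂ : Reaches P d e) :
    Reaches P c e := by
  obtain ⟨m, hm, rfl⟩ := h₁
  obtain ⟨n, _, rfl⟩ := h₂
  exact ⟨n + m, by omega, Function.iterate_add_apply _ _ _ _⟩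

theorem Reaches.of_instr {P : Program} {l : ℕ} {i : Instr} (h : P l = some i) (σ : ℕ → ℕ) :
    Reaches P (l, σ) (i.exec σ) :=
  ⟨1, one_pos, by simp [step, h]⟩

/-- A transformation of the registers is implementable if it is carried out by a program
fragment that can be placed anywhere, with any exit label. -/
def Implementable (T : (ℕ → ℕ) → ℕ → ℕ) : Prop :=
  ∃ len, ∀ k e, ∃ p : Program, ∀ P : Program, (∀ i, k ≤ i → i < k + len → P i = p i) →
    ∀ σ, Reaches P (k, σ) (e, T σ)

theorem implementable_inc (r : ℕ) :
    Implementable fun σ => Function.update σ r (σ r + 1) := by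
  refine ⟨1, fun k e => ⟨fun _ => some (.inc r e), fun P hP σ => ?_⟩⟩
  exact Reaches.of_instr (hP k le_rfl (by omega)) σ

theorem Implementable.comp {S T : (ℕ → ℕ) → ℕ → ℕ} (hS : Implementable S)
    (hT : Implementable T) : Implementable fun σ => T (S σ) := by
  obtain ⟨m, hm⟩ := hS
  obtain ⟨n, hn⟩ := hT
  refine ⟨m + n, fun k e => ?_⟩
  obtain ⟨p, hp⟩ := hm k (k + m)
  obtain ⟨q, hq⟩ := hn (k + m) e
  refine ⟨fun i => if i < k + m then p i else q i, fun P hP σ => ?_⟩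
  refine (hp P (fun i h₁ h₂ => ?_) σ).trans (hq P (fun i h₁ h₂ => ?_) _)
  · exact (hP i h₁ (by omega)).trans (if_pos h₂)
  · exact (hP i (by omega) (by omega)).trans (if_neg (by omega))

theorem implementable_clear (r : ℕ) : Implementable fun σ => Function.update σ r 0 := by
  refine ⟨1, fun k e => ⟨fun _ => some (.dec r k e), fun P hP σ => ?_⟩⟩
  have hk := hP k le_rfl (by omega)
  generalize hn : σ r = n
  induction n generalizing σ with
  | zero =>
    have := Reaches.of_instr hk σ
    rw [Instr.exec, if_pos hn] at this
    change Reaches P (k, σ) (e, Function.update σ r 0)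
    rwa [← hn, Function.update_eq_self]
  | succ n ih =>
    have := Reaches.of_instr hk σ
    rw [Instr.exec, if_neg (by omega)] at this
    simpa using this.trans (ih _ (by simp [hn]))

/-- The loop that decrements `r` and executes `T` as long as `r` is not zero. -/
theorem Implementable.loop {T : (ℕ → ℕ) → ℕ → ℕ} (hT : Implementable T) (r : ℕ)
    (hr : ∀ σ, T σ r = σ r) :
    ∃ S, Implementable S ∧ ∀ (σ : ℕ → ℕ) (I : ℕ → (ℕ → ℕ) → Prop), I 0 σ →
      (∀ j τ, τ r = σ r - j → I j τ → I (j + 1) (T (Function.update τ r (τ r - 1)))) →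
      I (σ r) (S σ) ∧ S σ r = 0 := by
  set B : (ℕ → ℕ) → ℕ → ℕ := fun τ => T (Function.update τ r (τ r - 1)) with hB
  refine ⟨fun σ => B^[σ r] σ, ?_, fun σ I h0 hs => ?_⟩
  · obtain ⟨n, hn⟩ := hT
    refine ⟨n + 1, fun k e => ?_⟩
    obtain ⟨p, hp⟩ := hn (k + 1) k
    refine ⟨fun i => if i = k then some (.dec r (k + 1) e) else p i, fun P hP σ => ?_⟩
    have hk := hP k le_rfl (by omega)
    replace hk := hk.trans (if_pos rfl)
    have hbody := hp P fun i h₁ h₂ =>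
      (hP i (by omega) (by omega)).trans (if_neg (by omega))
    change Reaches P (k, σ) (e, B^[σ r] σ)
    generalize hm : σ r = m
    induction m generalizing σ with
    | zero =>
      have := Reaches.of_instr hk σ
      rwa [Instr.exec, if_pos hm] at this
    | succ m ih =>
      have := Reaches.of_instr hk σ
      rw [Instr.exec, if_neg (by omega)] at this
      exact (this.trans (hbody _)).trans (ih (B σ) (by simp [hB, hr, hm]))
  · have key : ∀ j, I j (B^[j] σ) ∧ (B^[j] σ) r = σ r - j := by
      intro j
      induction j with
      | zero => exact ⟨h0, rfl⟩
      | succ j ih =>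
        rw [Function.iterate_succ_apply']
        refine ⟨hs j _ ih.2 ih.1, ?_⟩
        simp only [hB, hr, Function.update_self]
        rw [← hB, ih.2, Nat.sub_sub]
    exact ⟨(key _).1, by simpa using (key (σ r)).2⟩

/-- One loop empties `a` into both `c` and the scratch register `t`; a second one refills `a` from
`t`. -/
theorem implementable_copy {a c t : ℕ} (hac : a ≠ c) (hat : a ≠ t) (hct : c ≠ t) :
    ∃ S, Implementable S ∧ ∀ σ, S σ c = σ a ∧ ∀ q, q ≠ c → q ≠ t → S σ q = σ q := by
  obtain ⟨S₁, hS₁, h₁⟩ := ((implementable_inc c).comp (implementable_inc t)).loop a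
    (fun σ => by simp [hac, hat])
  obtain ⟨S₂, hS₂, h₂⟩ := (implementable_inc a).loop t (fun σ => by simp [hat.symm])
  refine ⟨_, (((implementable_clear c).comp (implementable_clear t)).comp hS₁).comp hS₂,
    fun σ => ?_⟩
  set ρ := Function.update (Function.update σ c 0) t 0 with hρ
  have e₁ := h₁ ρ (fun j τ => τ c = j ∧ τ t = j ∧ ∀ q, q ≠ c → q ≠ t → q ≠ a → τ q = σ q)
    ⟨by simp [hρ, hct], by simp [hρ], fun q h h' _ => by simp [hρ, h, h']⟩
    (fun j τ _ ⟨hc, ht, hq⟩ => ⟨by simp [hct, hac.symm, hc], by simp [hct.symm, hat.symm, ht],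
      fun q h h' h'' => by simp [h, h', h'', hq q h h' h'']⟩)
  have hρa : ρ a = σ a := by simp [hρ, hac, hat]
  rw [hρa] at e₁
  obtain ⟨⟨hc, ht, hq⟩, ha⟩ := e₁
  have e₂ := h₂ (S₁ ρ) (fun j τ => τ a = j ∧ ∀ q, q ≠ a → q ≠ t → τ q = S₁ ρ q)
    ⟨ha, fun _ _ _ => rfl⟩
    (fun j τ _ ⟨h, h'⟩ => ⟨by simp [hat, h], fun q hqa hqt => by simp [hqa, hqt, h' q hqa hqt]⟩)
  rw [ht] at e₂
  refine ⟨(e₂.1.2 c hac.symm hct).trans hc, fun q hqc hqt => ?_⟩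
  by_cases hqa : q = a
  · subst hqa
    exact e₂.1.1
  · exact (e₂.1.2 q hqa hqt).trans (hq q hqc hqt hqa)

open List.Vector in
/-- Every primitive recursive function is computed by a fragment that reads its arguments from
arbitrary registers below `b`, writes its value into `b`, and restores the registers
below `b`. -/
theorem implementable_of_primrec {n : ℕ} {f : List.Vector ℕ n → ℕ} (hf : Nat.Primrec' f) :
    ∀ (b : ℕ) (ρ : Fin n → ℕ), (∀ i, ρ i < b) → ∃ S, Implementable S ∧
      ∀ σ, S σ b = f (ofFn fun i => σ (ρ i)) ∧ ∀ q < b, S σ q = σ q := by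
  induction hf with
  | zero =>
    intro b ρ _
    exact ⟨_, implementable_clear b, fun σ => ⟨by simp, fun q hq => by simp [hq.ne]⟩⟩
  | succ =>
    intro b ρ hρ
    obtain ⟨S, hS, h⟩ := implementable_copy (hρ 0).ne ((hρ 0).trans b.lt_succ_self).ne
      b.lt_succ_self.ne
    exact ⟨_, hS.comp (implementable_inc b), fun σ => ⟨by simp [h, ofFn], fun q hq => by
      simp [hq.ne, (h σ).2 q hq.ne (by omega)]⟩⟩
  | get i =>
    intro b ρ hρ
    obtain ⟨S, hS, h⟩ := implementable_copy (hρ i).ne ((hρ i).trans b.lt_succ_self).ne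
      b.lt_succ_self.ne
    exact ⟨S, hS, fun σ => ⟨by simp [h], fun q hq => (h σ).2 q hq.ne (by omega)⟩⟩
  | @comp n m f g _ _ ihf ihg =>
    intro b ρ hρ
    have args : ∀ k ≤ m, ∃ S, Implementable S ∧ ∀ σ, (∀ i : Fin m, i.val < k →
        S σ (b + i) = g i (ofFn fun i => σ (ρ i))) ∧ ∀ q < b, S σ q = σ q := by
      intro k
      induction k with
      | zero =>
        intro _
        -- Any fragment that spares the registers below `b` would do; one is needed because
        -- `Reaches` demands at least one step.
        exact ⟨_, implementable_clear b, fun σ => ⟨by simp, fun q hq => by simp [hq.ne]⟩⟩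
      | succ k ih =>
        intro hk
        obtain ⟨S, hS, h⟩ := ih (by omega)
        obtain ⟨T, hT, h'⟩ := ihg ⟨k, hk⟩ (b + k) ρ (fun i => by have := hρ i; omega)
        refine ⟨_, hS.comp hT, fun σ => ⟨fun i hi => ?_, fun q hq => ?_⟩⟩
        · rcases Nat.lt_succ_iff_lt_or_eq.1 hi with hi | hi
          · rw [(h' _).2 _ (by omega), (h σ).1 i hi]
          · obtain rfl : i = ⟨k, hk⟩ := Fin.ext hi
            rw [(h' _).1]
            congr 2
            funext j
            exact (h σ).2 _ (hρ j)
        · rw [(h' _).2 _ (by omega), (h σ).2 q hq]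
    obtain ⟨S, hS, h⟩ := args m le_rfl
    -- The value goes to `b + m + 1`, not `b + m`, so that it differs from `b` even if `m = 0`, as
    -- copying requires.
    obtain ⟨T, hT, h'⟩ := ihf (b + m + 1) (fun i => b + i) (fun i => by omega)
    obtain ⟨C, hC, h''⟩ := implementable_copy (a := b + m + 1) (c := b) (t := b + m + 2)
      (by omega) (by omega) (by omega)
    refine ⟨_, (hS.comp hT).comp hC, fun σ => ⟨?_, fun q hq => ?_⟩⟩
    · rw [(h'' _).1, (h' _).1]
      congr 2
      funext i
      exact (h σ).1 i i.2
    · rw [(h'' _).2 q hq.ne (by omega), (h' _).2 q (by omega), (h σ).2 q hq]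
  | @prec n f g _ _ ihf ihg =>
    intro b ρ hρ
    have hρ0 := hρ 0
    -- Register `b` holds the value so far, `b + 1` counts the rounds done, `b + 2` the rounds left,
    -- and `b + 3` receives the value of `g`.
    obtain ⟨F, hF, hf⟩ := ihf b (fun i => ρ i.succ) (fun i => hρ _)
    obtain ⟨C, hC, hc⟩ := implementable_copy (a := ρ 0) (c := b + 2) (t := b + 3)
      (by omega) (by omega) (by omega)
    obtain ⟨G, hG, hg⟩ := ihg (b + 3) (Fin.cons (b + 1) (Fin.cons b fun i => ρ i.succ)) (by
      refine Fin.cases (by simp) (Fin.cases (by simp) fun i => ?_)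
      have := hρ i.succ
      simp only [Fin.cons_succ]
      omega)
    obtain ⟨D, hD, hd⟩ := implementable_copy (a := b + 3) (c := b) (t := b + 4)
      (by omega) (by omega) (by omega)
    obtain ⟨L, hL, hl⟩ := ((hG.comp hD).comp (implementable_inc (b + 1))).loop (b + 2)
      (fun σ => by
        rw [Function.update_of_ne (by omega), (hd _).2 _ (by omega) (by omega),
          (hg _).2 _ (by omega)])
    refine ⟨_, ((hF.comp (implementable_clear (b + 1))).comp hC).comp hL, fun σ => ?_⟩
    set τ := C (Function.update (F σ) (b + 1) 0) with hτ
    have hτ2 : τ (b + 2) = σ (ρ 0) := by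
      rw [hτ, (hc _).1, Function.update_of_ne (by omega), (hf σ).2 _ hρ0]
    have hτ1 : τ (b + 1) = 0 := by
      rw [hτ, (hc _).2 _ (by omega) (by omega), Function.update_self]
    have hτ0 : τ b = f (ofFn fun i => σ (ρ i.succ)) := by
      rw [hτ, (hc _).2 _ (by omega) (by omega), Function.update_of_ne (by omega), (hf σ).1]
    have hτq : ∀ q < b, τ q = σ q := fun q hq => by
      rw [hτ, (hc _).2 _ (by omega) (by omega), Function.update_of_ne (by omega), (hf σ).2 q hq]
    have key := hl τ (fun j τ => τ (b + 1) = j ∧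
        τ b = Nat.rec (f (ofFn fun i => σ (ρ i.succ)))
          (fun y IH => g (y ::ᵥ IH ::ᵥ ofFn fun i => σ (ρ i.succ))) j ∧
        ∀ q < b, τ q = σ q)
      ⟨hτ1, hτ0, hτq⟩
      (by
        rintro j τ - ⟨h1, h0, hq⟩
        set υ := Function.update τ (b + 2) (τ (b + 2) - 1) with hυ
        have hυq : ∀ q, q < b + 2 → υ q = τ q := fun q h => by
          rw [hυ, Function.update_of_ne (by omega)]
        refine ⟨?_, ?_, fun q h => ?_⟩
        · rw [Function.update_self, (hd _).2 _ (by omega) (by omega), (hg _).2 _ (by omega),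
            hυq _ (by omega), h1]
        · rw [Function.update_of_ne (by omega), (hd _).1, (hg _).1]
          congr 1
          have e : (fun i : Fin n => υ (ρ i.succ)) = fun i => σ (ρ i.succ) := by
            funext i
            rw [hυq _ (by have := hρ i.succ; omega), hq _ (hρ _)]
          rw [← h0, ← h1, ← e, ← hυq b (by omega), ← hυq (b + 1) (by omega)]
          rfl
        · rw [Function.update_of_ne (by omega), (hd _).2 _ (by omega) (by omega),
            (hg _).2 _ (by omega), hυq _ (by omega), hq q h])
    rw [hτ2] at key
    refine ⟨?_, key.1.2.2⟩
    rw [key.1.2.1]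
    simp [ofFn]

/-! ### A fixed machine with an undecidable halting problem -/

/-- The initial configuration with input `m`. -/
def start (m : ℕ) : Config := (0, Function.update 0 0 m)

/-- The run with input `m` stops. -/
def Halts (P : Program) (m : ℕ) : Prop :=
  ∃ n, P ((step P)^[n] (start m)).1 = none

theorem iterate_step_of_stopped {P : Program} {c : Config} (h : P c.1 = none) (n : ℕ) :
    (step P)^[n] c = c :=
  Function.iterate_fixed (by simp [step, h]) n

/-- A counter machine can search for a zero of a primitive recursive function. -/
theorem exists_program_halts_iff {g : ℕ → ℕ → ℕ} (hg : Primrec₂ g) :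
    ∃ P : Program, (∃ N, ∀ l, N ≤ l → P l = none) ∧ ∀ m, Halts P m ↔ ∃ k, g m k = 0 := by
  obtain ⟨S, ⟨len, hlen⟩, hS⟩ := implementable_of_primrec (Nat.Primrec'.prim_iff₂.2 hg) 2
    (fun i => i) (fun i => i.2)
  obtain ⟨p, hp⟩ := hlen 0 len
  -- The fragment puts `g` of registers 0 and 1 into register 2. A non-zero value leads to the next
  -- candidate in register 1 and back to label 0, zero to the stop label `len + 2`.
  let P : Program := fun l => if l < len then p l else
    if l = len then some (.dec 2 (len + 1) (len + 2)) else
    if l = len + 1 then some (.inc 1 0) else none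
  have hS' : ∀ σ, S σ 2 = g (σ 0) (σ 1) ∧ S σ 0 = σ 0 ∧ S σ 1 = σ 1 := fun σ =>
    ⟨by rw [(hS σ).1]; simp [List.Vector.ofFn], (hS σ).2 0 (by simp), (hS σ).2 1 (by simp)⟩
  have run := hp P fun i _ h => if_pos (by omega)
  have hdec : P len = some (.dec 2 (len + 1) (len + 2)) := by simp [P]
  have hinc : P (len + 1) = some (.inc 1 0) := by simp [P]
  have found : ∀ σ, g (σ 0) (σ 1) = 0 → Reaches P (0, σ) (len + 2, S σ) := fun σ h => by
    have := Reaches.of_instr hdec (S σ)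
    rw [Instr.exec, if_pos (by rw [(hS' σ).1, h])] at this
    exact (run σ).trans this
  have next : ∀ σ, g (σ 0) (σ 1) ≠ 0 → ∃ τ, Reaches P (0, σ) (0, τ) ∧ τ 0 = σ 0 ∧
      τ 1 = σ 1 + 1 := fun σ h => by
    have h₁ := Reaches.of_instr hdec (S σ)
    rw [Instr.exec, if_neg (by rwa [(hS' σ).1])] at h₁
    exact ⟨_, ((run σ).trans h₁).trans (Reaches.of_instr hinc _), by simp [hS'], by simp [hS']⟩
  refine ⟨P, ⟨len + 2, fun l hl => ?_⟩, fun m => ⟨fun ⟨n, hn⟩ => ?_, fun hk => ?_⟩⟩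
  · simp only [P]
    rw [if_neg (by omega), if_neg (by omega), if_neg (by omega)]
  · by_contra! hk
    -- Without a zero the run returns to label 0 arbitrarily late, with register 1 growing each
    -- time, whereas a stopped configuration is frozen.
    have key : ∀ N, ∃ n σ, N ≤ n ∧ (step P)^[n] (start m) = (0, σ) ∧ σ 0 = m := by
      intro N
      induction N with
      | zero => exact ⟨0, _, le_rfl, rfl, by simp⟩
      | succ N ih =>
        obtain ⟨n, σ, hn, hσ, h0⟩ := ih
        obtain ⟨τ, ⟨n', hn', e⟩, hτ0, -⟩ := next σ (by rw [h0]; exact hk _)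
        exact ⟨n' + n, τ, by omega, by rw [Function.iterate_add_apply, hσ, e], hτ0.trans h0⟩
    obtain ⟨n', σ, hn', hσ, h0⟩ := key n
    obtain ⟨τ, ⟨n'', hn'', e⟩, -, h1⟩ := next σ (by rw [h0]; exact hk _)
    obtain ⟨d, rfl⟩ := Nat.exists_eq_add_of_le' hn'
    rw [Function.iterate_add_apply, iterate_step_of_stopped hn] at hσ
    rw [hσ] at hn
    rw [iterate_step_of_stopped hn, Prod.mk.injEq] at e
    rw [e.2] at h1
    omega
  · have key : ∀ k, (∃ n, P ((step P)^[n] (start m)).1 = none) ∨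
        ∃ n σ, (step P)^[n] (start m) = (0, σ) ∧ σ 0 = m ∧ σ 1 = k := by
      intro k
      induction k with
      | zero => exact Or.inr ⟨0, _, rfl, by simp, by simp⟩
      | succ k ih =>
        rcases ih with ih | ⟨n, σ, hσ, h0, h1⟩
        · exact Or.inl ih
        by_cases h : g (σ 0) (σ 1) = 0
        · obtain ⟨n', -, e⟩ := found σ h
          exact Or.inl ⟨n' + n, by rw [Function.iterate_add_apply, hσ, e]; simp [P]⟩
        · obtain ⟨τ, ⟨n', -, e⟩, hτ0, hτ1⟩ := next σ h
          exact Or.inr ⟨n' + n, τ, by rw [Function.iterate_add_apply, hσ, e], hτ0.trans h0,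
            by rw [hτ1, h1]⟩
    obtain ⟨k, hk⟩ := hk
    rcases key k with h | ⟨n, σ, hσ, rfl, rfl⟩
    · exact h
    · obtain ⟨n', -, e⟩ := found σ hk
      exact ⟨n' + n, by rw [Function.iterate_add_apply, hσ, e]; simp [P]⟩

open Nat.Partrec (Code) in
/-- There is a fixed counter machine with an undecidable halting problem. -/
theorem exists_undecidable_program : ∃ P : Program, (∃ N, ∀ l, N ≤ l → P l = none) ∧
    ¬ ComputablePred (Halts P) := by
  let g : ℕ → ℕ → ℕ := fun m k =>
    cond (Code.evaln k (Denumerable.ofNat Code m) 0).isSome 0 1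
  have hg : Primrec₂ g := by
    refine Primrec.cond (Primrec.option_isSome.comp (Code.primrec_evaln.comp
      ((Primrec.snd.pair ((Primrec.ofNat Code).comp Primrec.fst)).pair (Primrec.const 0))))
      (Primrec.const 0) (Primrec.const 1)
  obtain ⟨P, hN, hP⟩ := exists_program_halts_iff hg
  refine ⟨P, hN, fun h => ComputablePred.halting_problem 0 ?_⟩
  refine ComputablePred.computable_of_manyOneReducible
    (q := Halts P) ⟨Encodable.encode, Computable.encode, fun c => ?_⟩ h
  change (Code.eval c 0).Dom ↔ _
  rw [hP, Part.dom_iff_mem]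
  simp only [Code.evaln_complete, g, Denumerable.ofNat_encode]
  rw [exists_comm]
  refine exists_congr fun k => ?_
  cases h : Code.evaln k c 0 <;> simp

/-- The largest register or label that occurs in an instruction. -/
def Instr.bound : Instr → ℕ
  | inc r t => max r t
  | dec r t u => max r (max t u)

/-- All registers and target labels of the program are at most `B`. -/
def BoundedBy (P : Program) (B : ℕ) : Prop :=
  ∀ l i, P l = some i → i.bound ≤ B

theorem exists_boundedBy {P : Program} {N : ℕ} (hN : ∀ l, N ≤ l → P l = none) :
    ∃ B, BoundedBy P B := by
  refine ⟨(Finset.range N).sup fun l => (P l).elim 0 Instr.bound, fun l i h => ?_⟩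
  have hl : l ∈ Finset.range N := by
    by_contra hl
    simp [hN l (by simpa using hl)] at h
  exact le_of_eq_of_le (by simp [h]) (Finset.le_sup (f := fun l => (P l).elim 0 Instr.bound) hl)

end CounterMachine

namespace OneVarModal

open CounterMachine

/-! ### Formulas that describe programs and inputs -/

namespace Formula

variable {M : Type v}

/-- Disjunction, as an abbreviation. -/
def or (φ ψ : Formula M) : Formula M := neg (and (neg φ) (neg ψ))

/-- Equivalence, as an abbreviation. -/
def iff (φ ψ : Formula M) : Formula M := and (φ.imp ψ) (ψ.imp φ)

/-- The possibility operators, as abbreviations. -/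
def dia (m : M) (φ : Formula M) : Formula M := neg (box m (neg φ))

/-- The conjunction of `f 0, …, f n`. -/
def conj (f : ℕ → Formula M) : ℕ → Formula M
  | 0 => f 0
  | n + 1 => and (conj f n) (f (n + 1))

/-- The number of elements of this predicate is the value of register `q`. -/
def reg (q : ℕ) : Formula M := pred (4 * q) .x

/-- The current label is `l`, and the next step follows the operator of direction `d`. -/
def lab (d : Bool) (l : ℕ) : Formula M := pred (cond d (4 * l + 1) (4 * l + 2)) (.const 0)

/-- At all accessible worlds that satisfy `χ`, register `q` is given by `θ`. -/
def assign (m : M) (χ : Formula M) (q : ℕ) (θ : Formula M) : Formula M :=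
  all (and (θ.imp (box m (χ.imp (reg q)))) ((neg θ).imp (box m (χ.imp (neg (reg q))))))

/-- There is a successor with label `t`, and at every such successor the registers up to `B`
are given by `θ`. -/
def move (m : Bool → M) (B : ℕ) (d : Bool) (t : ℕ) (θ : ℕ → Formula M) : Formula M :=
  and (dia (m d) (lab (!d) t)) (conj (fun q => assign (m d) (lab (!d) t) q (θ q)) B)

/-- The effect of an instruction. The constant `c₀` names the element that is added to or removed
from a register. -/
def effect (m : Bool → M) (B : ℕ) (d : Bool) : Option Instr → Formula M
  | none => neg (eq .x .x)
  | some (.inc r t) => and (neg (pred (4 * r) (.const 0)))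
      (move m B d t fun q => if q = r then (reg q).or (eq .x (.const 0)) else reg q)
  | some (.dec r t u) => and
      ((ex (reg r)).imp (and (pred (4 * r) (.const 0))
        (move m B d t fun q => if q = r then (reg q).and (neg (eq .x (.const 0))) else reg q)))
      ((neg (ex (reg r))).imp (move m B d u reg))

/-- The description of a program. -/
def program (m : Bool → M) (B : ℕ) (P : Program) : Formula M :=
  conj (fun l => and ((lab true l).imp (effect m B true (P l)))
    ((lab false l).imp (effect m B false (P l)))) B

/-- The auxiliary predicate with number `n + 1` has one more element than that with number `n`. -/
def increment (n : ℕ) : Formula M :=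
  and (neg (pred (4 * n + 3) (.const (n + 1))))
    (all (iff (pred (4 * (n + 1) + 3) .x)
      (or (pred (4 * n + 3) .x) (eq .x (.const (n + 1))))))

/-- The auxiliary predicate with number `n` has `n` elements. -/
def numeral : ℕ → Formula M
  | 0 => neg (ex (pred 3 .x))
  | n + 1 => and (numeral n) (increment n)

/-- The description of the initial configuration with input `n`. -/
def input (B n : ℕ) : Formula M :=
  -- Register 0 is fixed by the numeral; at `q = 0` the conjunct merely repeats the label.
  and (and (lab true 0) (conj (fun q => if q = 0 then lab true 0 else neg (ex (reg q))) B))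
    (and (numeral n) (all (iff (reg 0) (pred (4 * n + 3) .x))))

/-- The formula `φ` is true at all worlds reached in at most `n` steps along alternating
operators. -/
def alternating (m : Bool → M) (φ : Formula M) : ℕ → Bool → Formula M
  | 0, _ => φ
  | n + 1, d => and φ (box (m d) (alternating m φ n (!d)))

end Formula

open Formula

/-! ### Truth conditions and the simulation of a run -/

section Semantics

variable {M : Type v} {F : Frame.{u} M} (𝔐 : CDModel F) (s : F.W) (a : 𝔐.Dom)

@[simp] theorem sat_neg (φ : Formula M) : 𝔐.Sat s a (neg φ) ↔ ¬ 𝔐.Sat s a φ := Iff.rfl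

@[simp] theorem sat_and (φ ψ : Formula M) :
    𝔐.Sat s a (.and φ ψ) ↔ 𝔐.Sat s a φ ∧ 𝔐.Sat s a ψ := Iff.rfl

@[simp] theorem sat_ex (φ : Formula M) : 𝔐.Sat s a (ex φ) ↔ ∃ b, 𝔐.Sat s b φ := Iff.rfl

@[simp] theorem sat_box (m : M) (φ : Formula M) :
    𝔐.Sat s a (box m φ) ↔ ∀ s', F.R m s s' → 𝔐.Sat s' a φ := Iff.rfl

@[simp] theorem sat_imp (φ ψ : Formula M) :
    𝔐.Sat s a (φ.imp ψ) ↔ (𝔐.Sat s a φ → 𝔐.Sat s a ψ) := by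
  simp [imp]

@[simp] theorem sat_all (φ : Formula M) : 𝔐.Sat s a φ.all ↔ ∀ b, 𝔐.Sat s b φ := by
  simp [all]

@[simp] theorem sat_or (φ ψ : Formula M) :
    𝔐.Sat s a (φ.or ψ) ↔ 𝔐.Sat s a φ ∨ 𝔐.Sat s a ψ := by
  simp only [Formula.or, sat_neg, sat_and]
  tauto

@[simp] theorem sat_iff (φ ψ : Formula M) :
    𝔐.Sat s a (φ.iff ψ) ↔ (𝔐.Sat s a φ ↔ 𝔐.Sat s a ψ) := by
  simp only [Formula.iff, sat_imp, sat_and]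
  tauto

@[simp] theorem sat_dia (m : M) (φ : Formula M) :
    𝔐.Sat s a (dia m φ) ↔ ∃ s', F.R m s s' ∧ 𝔐.Sat s' a φ := by
  simp [dia]

@[simp] theorem sat_conj (f : ℕ → Formula M) (n : ℕ) :
    𝔐.Sat s a (conj f n) ↔ ∀ i ≤ n, 𝔐.Sat s a (f i) := by
  induction n with
  | zero => simp [conj]
  | succ n ih => simp [conj, ih, Nat.le_succ_iff, or_imp, forall_and]

@[simp] theorem sat_reg (q : ℕ) : 𝔐.Sat s a (reg q) ↔ a ∈ 𝔐.pred s (4 * q) := Iff.rfl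

@[simp] theorem sat_pred_x (n : ℕ) : 𝔐.Sat s a (.pred n .x) ↔ a ∈ 𝔐.pred s n := Iff.rfl

@[simp] theorem sat_pred_const (n k : ℕ) :
    𝔐.Sat s a (.pred n (.const k)) ↔ 𝔐.const s k ∈ 𝔐.pred s n := Iff.rfl

@[simp] theorem sat_eq_const (k : ℕ) :
    𝔐.Sat s a (.eq .x (.const k)) ↔ a = 𝔐.const s k := Iff.rfl

/-- The world `s` carries the label `l` of direction `d`. -/
def HasLabel (d : Bool) (l : ℕ) : Prop :=
  𝔐.const s 0 ∈ 𝔐.pred s (cond d (4 * l + 1) (4 * l + 2))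

@[simp] theorem sat_lab (d : Bool) (l : ℕ) :
    𝔐.Sat s a (lab d l) ↔ HasLabel 𝔐 s d l := Iff.rfl

/-- The element assigned to `x` persists across the box, while `θ`, including `c₀`, is evaluated
before the step. Treating `θ` and its negation separately fixes the register exactly. -/
theorem sat_assign (m : M) (d : Bool) (l q : ℕ) (θ : Formula M) :
    𝔐.Sat s a (assign m (lab d l) q θ) ↔ ∀ s', F.R m s s' → HasLabel 𝔐 s' d l →
      𝔐.pred s' (4 * q) = {b | 𝔐.Sat s b θ} := by
  simp only [assign, sat_all, sat_and, sat_imp, sat_box, sat_lab, sat_reg, sat_neg, Set.ext_iff,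
    Set.mem_ofPred_eq]
  constructor
  · intro h s' hs hl b
    by_cases hb : 𝔐.Sat s b θ
    · simpa [hb] using (h b).1 hb s' hs hl
    · simpa [hb] using (h b).2 hb s' hs hl
  · exact fun h b => ⟨fun hb s' hs hl => (h s' hs hl b).2 hb,
      fun hb s' hs hl hq => hb ((h s' hs hl b).1 hq)⟩

theorem sat_move (m : Bool → M) (B : ℕ) (d : Bool) (t : ℕ) (θ : ℕ → Formula M) :
    𝔐.Sat s a (move m B d t θ) ↔ (∃ s', F.R (m d) s s' ∧ HasLabel 𝔐 s' (!d) t) ∧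
      ∀ q ≤ B, ∀ s', F.R (m d) s s' → HasLabel 𝔐 s' (!d) t →
        𝔐.pred s' (4 * q) = {b | 𝔐.Sat s b (θ q)} := by
  simp [move, sat_assign]

/-- The world `s` represents a configuration of a counter machine. -/
def Represents (B : ℕ) (d : Bool) (c : Config) : Prop :=
  HasLabel 𝔐 s d c.1 ∧ c.1 ≤ B ∧ ∀ q ≤ B, (𝔐.pred s (4 * q)).encard = c.2 q

variable {𝔐 s a}

theorem represents_start {B n : ℕ} (h : 𝔐.Sat s a (input B n)) :
    Represents 𝔐 s B true (start n) := by
  have numeral_encard : ∀ n, 𝔐.Sat s a (numeral n) → (𝔐.pred s (4 * n + 3)).encard = n := by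
    intro n
    induction n with
    | zero =>
      intro h
      simp only [numeral, sat_neg, sat_ex, sat_pred_x, not_exists] at h
      simpa [Set.eq_empty_iff_forall_notMem] using h
    | succ n ih =>
      intro h
      simp only [numeral, increment, sat_and, sat_neg, sat_pred_const, sat_all, sat_iff,
        sat_pred_x, sat_or, sat_eq_const] at h
      obtain ⟨h₁, h₂, h₃⟩ := h
      have : 𝔐.pred s (4 * (n + 1) + 3) = insert (𝔐.const s (n + 1)) (𝔐.pred s (4 * n + 3)) := by
        ext b
        rw [h₃ b, Set.mem_insert_iff, or_comm]
      rw [this, Set.encard_insert_of_notMem h₂, ih h₁]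
      simp
  simp only [input, sat_and, sat_lab, sat_conj, sat_all, sat_iff, sat_reg, sat_pred_x] at h
  obtain ⟨⟨h₁, h₂⟩, h₃, h₄⟩ := h
  refine ⟨h₁, Nat.zero_le _, fun q hq => ?_⟩
  rcases eq_or_ne q 0 with rfl | h0
  · rw [show (start n).2 0 = n by simp [start], ← numeral_encard n h₃]
    exact congrArg _ (Set.ext h₄)
  · have := h₂ q hq
    rw [if_neg h0] at this
    simp only [sat_neg, sat_ex, sat_reg, not_exists] at this
    simpa [start, h0, Set.eq_empty_iff_forall_notMem] using this

/-- The value of `c₀` lies outside a register about to be incremented and inside one about to be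
decremented, so inserting or removing it changes the cardinality by exactly one. -/
theorem exists_represents_step {m : Bool → M} {B : ℕ} {P : Program} (hB : BoundedBy P B)
    (h : 𝔐.Sat s a (program m B P)) {d : Bool} {c : Config} (hc : Represents 𝔐 s B d c) :
    P c.1 ≠ none ∧ ∃ s', F.R (m d) s s' ∧ Represents 𝔐 s' B (!d) (step P c) := by
  obtain ⟨l, σ⟩ := c
  obtain ⟨hl, hlB, hσ⟩ := hc
  dsimp only at hl hlB hσ
  have heff : 𝔐.Sat s a (effect m B d (P l)) := by
    simp only [program, sat_conj, sat_and, sat_imp, sat_lab] at h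
    cases d
    · exact (h l hlB).2 hl
    · exact (h l hlB).1 hl
  rcases hP : P l with _ | ⟨r, t⟩ | ⟨r, t, u⟩
  · rw [hP] at heff
    exact absurd rfl heff
  · have hb := hB l _ hP
    simp only [Instr.bound, max_le_iff] at hb
    rw [hP] at heff
    simp only [effect, sat_and, sat_neg, sat_pred_const, sat_move] at heff
    obtain ⟨hr, ⟨s', hs, hs'⟩, ha⟩ := heff
    refine ⟨by simp, s', hs, ?_⟩
    simp only [step, hP, Option.elim_some, Instr.exec]
    refine ⟨hs', hb.2, fun q hq => ?_⟩
    rw [ha q hq s' hs hs']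
    dsimp only
    rcases eq_or_ne q r with rfl | hqr
    · rw [Function.update_self, Nat.cast_add, Nat.cast_one, ← hσ q hq,
        ← Set.encard_insert_of_notMem hr]
      congr 1
      ext b
      simp [or_comm]
    · simp only [if_neg hqr, Function.update_of_ne hqr]
      exact hσ q hq
  · have hb := hB l _ hP
    simp only [Instr.bound, max_le_iff] at hb
    rw [hP] at heff
    simp only [effect, sat_and, sat_imp, sat_neg, sat_ex, sat_reg, sat_pred_const,
      sat_move] at heff
    refine ⟨by simp, ?_⟩
    simp only [step, hP, Option.elim_some, Instr.exec]
    by_cases h0 : σ r = 0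
    · have hr : ¬ ∃ b, b ∈ 𝔐.pred s (4 * r) := by
        have := hσ r hb.1
        simp only [h0, Nat.cast_zero, Set.encard_eq_zero] at this
        simp [this]
      obtain ⟨⟨s', hs, hs'⟩, ha⟩ := heff.2 hr
      rw [if_pos h0]
      refine ⟨s', hs, hs', hb.2.2, fun q hq => ?_⟩
      rw [ha q hq s' hs hs']
      exact hσ q hq
    · have hr : ∃ b, b ∈ 𝔐.pred s (4 * r) := by
        refine Set.nonempty_iff_ne_empty.2 fun h => h0 ?_
        simpa [h] using (hσ r hb.1).symm
      obtain ⟨hcr, ⟨s', hs, hs'⟩, ha⟩ := heff.1 hr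
      rw [if_neg h0]
      refine ⟨s', hs, hs', hb.2.1, fun q hq => ?_⟩
      rw [ha q hq s' hs hs']
      dsimp only
      rcases eq_or_ne q r with rfl | hqr
      · have e : {b | 𝔐.Sat s b (if q = q then (reg q).and (neg (.eq .x (.const 0))) else reg q)} =
            𝔐.pred s (4 * q) \ {𝔐.const s 0} := by
          ext b
          simp
        have h₁ := Set.encard_sdiff_singleton_add_one hcr
        obtain ⟨k, hk⟩ := Nat.exists_eq_succ_of_ne_zero h0
        rw [hσ q hq, hk, Nat.succ_eq_add_one, Nat.cast_add, Nat.cast_one] at h₁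
        rw [e, Function.update_self, hk]
        simpa using h₁
      · simp only [if_neg hqr, Function.update_of_ne hqr]
        exact hσ q hq

theorem not_stopped_of_sat_alternating {m : Bool → M} {B : ℕ} {P : Program}
    (hB : BoundedBy P B) {n : ℕ} {d : Bool} {c : Config}
    (h : 𝔐.Sat s a (alternating m (program m B P) n d)) (hc : Represents 𝔐 s B d c) :
    P ((step P)^[n] c).1 ≠ none := by
  induction n generalizing s d c with
  | zero => exact (exists_represents_step hB h hc).1
  | succ n ih =>
    obtain ⟨-, s', hs, hc'⟩ := exists_represents_step hB h.1 hc
    exact ih (h.2 s' hs) hc'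

end Semantics

/-! ### From halting to derivability -/

section Consequence

variable {M : Type v} {C : Set (Frame.{u} M)} {φ ψ : Formula M}

theorem GlobalConsequence.semantic (h : GlobalConsequence (LogCDEq C) φ ψ) :
    SemanticGlobalConsequence C φ ψ := by
  intro F hF 𝔐 hφ
  induction h with
  | ax h => exact h F hF 𝔐
  | premise => exact hφ
  | mp _ _ ih₁ ih₂ => exact fun s a => (sat_imp 𝔐 s a _ _).1 (ih₁ s a) (ih₂ s a)
  | gen _ ih => exact fun s a => (sat_all 𝔐 s a _).2 fun b => ih s b
  | nec m _ ih => exact fun s a s' _ => ih s' a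

theorem GlobalConsequence.alternating (m : Bool → M) (φ : Formula M) (n : ℕ) (d : Bool) :
    GlobalConsequence (LogCDEq C) φ (Formula.alternating m φ n d) := by
  induction n generalizing d with
  | zero => exact .premise
  | succ n ih =>
    refine .mp (.mp (.ax fun F _ 𝔐 s a => ?_) .premise) (.nec (m d) (ih (!d)))
    simp only [Formula.alternating, sat_imp, sat_and]
    exact fun h₁ h₂ => ⟨h₁, h₂⟩

/-- The implication from `program` along `k` alternating steps to the negated input is valid, hence
an axiom; its antecedent is derivable by necessitation. -/
theorem globalConsequence_of_halts {m : Bool → M} {B : ℕ} {P : Program} (hB : BoundedBy P B)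
    {n : ℕ} (h : Halts P n) :
    GlobalConsequence (LogCDEq C) (program m B P) (neg (input B n)) := by
  obtain ⟨k, hk⟩ := h
  refine .mp (.ax fun F _ 𝔐 s a => ?_) (.alternating m _ k true)
  rw [sat_imp]
  exact fun h hi => not_stopped_of_sat_alternating hB h (represents_start hi) hk

end Consequence

/-! ### An infinite alternating path in a fusion -/

open Cardinal

/-- A bijection with prescribed values on a sequence exists if the complements of the ranges are
equinumerous. -/
theorem exists_equiv_extending {α β ι : Type u} {f : ι → α} {g : ι → β}
    (hf : Function.Injective f) (hg : Function.Injective g)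
    (h : #((Set.range f)ᶜ : Set α) = #((Set.range g)ᶜ : Set β)) :
    ∃ e : α ≃ β, ∀ i, e (f i) = g i := by
  classical
  obtain ⟨e'⟩ := Cardinal.eq.1 h
  refine ⟨(Equiv.Set.sumCompl _).symm.trans ((Equiv.sumCongr
    ((Equiv.ofInjective f hf).symm.trans (Equiv.ofInjective g hg)) e').trans
      (Equiv.Set.sumCompl _)), fun i => ?_⟩
  rw [Equiv.trans_apply, Equiv.Set.sumCompl_symm_apply_of_mem (Set.mem_range_self i)]
  have : (Equiv.ofInjective f hf).symm ⟨f i, Set.mem_range_self i⟩ = i :=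
    Equiv.ofInjective_symm_apply hf i
  simp [this]

/-- The missed points `b` in the copies indexed by `K` give the lower bound; `#K` also bounds the
size of the whole union. -/
theorem mk_compl_range_eq {K A : Type u} [Infinite K] [Nonempty A] (hA : #A ≤ #K) (b : A)
    (f : ULift.{u} ℕ → (Σ _ : ULift.{u} ℕ ⊕ K, A)) (hf : ∀ n k, f n ≠ ⟨.inr k, b⟩) :
    #((Set.range f)ᶜ : Set (Σ _ : ULift.{u} ℕ ⊕ K, A)) = #K := by
  have hK : ℵ₀ ≤ #K := Cardinal.aleph0_le_mk K
  refine le_antisymm ((Cardinal.mk_set_le _).trans ?_) ?_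
  · rw [Cardinal.mk_congr (Equiv.sigmaEquivProd _ _), Cardinal.mk_prod, Cardinal.mk_sum]
    simp only [Cardinal.lift_id, Cardinal.mk_uLift, Cardinal.mk_nat, Cardinal.lift_aleph0]
    rw [Cardinal.add_eq_right hK hK]
    exact Cardinal.mul_le_of_le hK le_rfl hA
  · refine Cardinal.mk_le_of_injective (f := fun k => ⟨⟨.inr k, b⟩, ?_⟩) ?_
    · rintro ⟨n, hn⟩
      exact hf n k hn
    · intro k k' h
      simpa using h

theorem disjointUnion_const_rel {M : Type v} {ι : Type u} [Nonempty ι] (F : Frame.{u} M) (m : M)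
    (i j : ι) (a b : F.W) :
    (Frame.disjointUnion fun _ : ι => F).R m ⟨i, a⟩ ⟨j, b⟩ ↔ i = j ∧ F.R m a b := by
  constructor
  · rintro ⟨k, c, d, h₁, h₂, h⟩
    simp only [Sigma.mk.injEq, heq_eq_eq] at h₁ h₂
    obtain ⟨rfl, rfl⟩ := h₁
    obtain ⟨rfl, rfl⟩ := h₂
    exact ⟨rfl, h⟩
  · rintro ⟨rfl, h⟩
    exact ⟨i, a, b, rfl, rfl, h⟩

/-- The terms `2 * i` and `2 * i + 1` share a copy of the frame that contains no other term, so an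
edge from `a` to `b` gives only the intended even-to-odd edges. -/
theorem exists_sequence_even {A : Type u} (K : Type u) {a b : A} (hab : a ≠ b) :
    ∃ f : ULift.{u} ℕ → (Σ _ : ULift.{u} ℕ ⊕ K, A), Function.Injective f ∧
      (∀ n c k, f n ≠ ⟨.inr k, c⟩) ∧ (∀ i, f ⟨2 * i⟩ = ⟨.inl ⟨i⟩, a⟩) ∧
      ∀ i, f ⟨2 * i + 1⟩ = ⟨.inl ⟨i⟩, b⟩ := by
  have he : ∀ i, (⟨.inl ⟨2 * i / 2⟩, if 2 * i % 2 = 0 then a else b⟩ :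
      Σ _ : ULift.{u} ℕ ⊕ K, A) = ⟨.inl ⟨i⟩, a⟩ := fun i => by simp
  have ho : ∀ i, (⟨.inl ⟨(2 * i + 1) / 2⟩, if (2 * i + 1) % 2 = 0 then a else b⟩ :
      Σ _ : ULift.{u} ℕ ⊕ K, A) = ⟨.inl ⟨i⟩, b⟩ := fun i => by
    rw [show (2 * i + 1) / 2 = i by omega, if_neg (by omega)]
  refine ⟨fun n => ⟨.inl ⟨n.down / 2⟩, if n.down % 2 = 0 then a else b⟩, ?_, by simp, he, ho⟩
  rintro ⟨i⟩ ⟨j⟩ h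
  dsimp only at h
  obtain ⟨i, rfl | rfl⟩ := Nat.even_or_odd' i <;> obtain ⟨j, rfl | rfl⟩ := Nat.even_or_odd' j
  · rw [he, he] at h
    simpa using h
  · rw [he, ho] at h
    simp [hab] at h
  · rw [he, ho] at h
    simp [hab.symm] at h
  · rw [ho, ho] at h
    simpa using h

/-- The pairing is shifted by one. The first term gets a copy of its own, so that no other term sees
it. -/
theorem exists_sequence_odd {A K : Type u} [Nonempty K] {a b : A} (hab : a ≠ b) :
    ∃ (k₀ : K) (f : ULift.{u} ℕ → (Σ _ : ULift.{u} ℕ ⊕ K, A)), Function.Injective f ∧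
      (∀ n k, f n ≠ ⟨.inr k, b⟩) ∧ f ⟨0⟩ = ⟨.inr k₀, a⟩ ∧
      (∀ i, f ⟨2 * i + 1⟩ = ⟨.inl ⟨i⟩, a⟩) ∧ ∀ i, f ⟨2 * (i + 1)⟩ = ⟨.inl ⟨i⟩, b⟩ := by
  obtain ⟨k₀⟩ := ‹Nonempty K›
  obtain ⟨f, hf, hk, he, ho⟩ := exists_sequence_even K hab
  refine ⟨k₀, fun n => Nat.casesOn n.down ⟨.inr k₀, a⟩ fun i => f ⟨i⟩, ?_, ?_, rfl, he, ho⟩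
  · rintro ⟨_ | i⟩ ⟨_ | j⟩ h
    · rfl
    · exact absurd h.symm (hk _ _ _)
    · exact absurd h (hk _ _ _)
    · simpa using hf h
  · rintro ⟨_ | i⟩ k
    · simp [hab]
    · exact hk _ _ _

/-- Some fusion of a frame in `C₁` and a frame in `C₂` has an infinite path of distinct worlds
whose edges alternate between the two relations, such that there are no further edges from even
to odd worlds of the path by the first relation and from odd to even worlds by the second. -/
theorem exists_alternating_path {M₁ : Type v} {M₂ : Type w}
    {C₁ : Set (Frame.{u} M₁)} {C₂ : Set (Frame.{u} M₂)} (iso₂ : ClosedUnderIso C₂)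
    (union₁ : ClosedUnderDisjointUnions C₁) (union₂ : ClosedUnderDisjointUnions C₂)
    (nontrivial₁ : ∃ F ∈ C₁, F.NonTrivial) (nontrivial₂ : ∃ F ∈ C₂, F.NonTrivial) :
    ∃ m : Bool → M₁ ⊕ M₂, ∃ F ∈ fusion C₁ C₂, ∃ f : ℕ → F.W, Function.Injective f ∧
      ∀ i j, i.bodd ≠ j.bodd → (F.R (m !i.bodd) (f i) (f j) ↔ j = i + 1) := by
  obtain ⟨F₁, hF₁, a₁, b₁, hab₁, m₁, hm₁⟩ := nontrivial₁
  obtain ⟨F₂, hF₂, a₂, b₂, hab₂, m₂, hm₂⟩ := nontrivial₂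
  have := F₁.nonempty
  have := F₂.nonempty
  -- With an infinite `K` at least as large as both frames, the worlds off the two sequences are
  -- equinumerous, whatever the frames are.
  obtain ⟨K, hK, hK₁, hK₂⟩ : ∃ K : Type u, Infinite K ∧ #F₁.W ≤ #K ∧ #F₂.W ≤ #K :=
    ⟨ULift.{u} ℕ ⊕ F₁.W ⊕ F₂.W, inferInstance,
      Cardinal.mk_le_of_injective (Sum.inr_injective.comp Sum.inl_injective),
      Cardinal.mk_le_of_injective (Sum.inr_injective.comp Sum.inr_injective)⟩
  obtain ⟨f₁, hf₁, h₁, f₁_even, f₁_odd⟩ := exists_sequence_even K hab₁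
  obtain ⟨k₀, f₂, hf₂, h₂, f₂_zero, f₂_odd, f₂_even⟩ := exists_sequence_odd (K := K) hab₂
  obtain ⟨e, he⟩ := exists_equiv_extending hf₁ hf₂
    ((mk_compl_range_eq hK₁ a₁ f₁ fun n => h₁ n a₁).trans (mk_compl_range_eq hK₂ b₂ f₂ h₂).symm)
  have hG₁ := union₁ (ULift.{u} ℕ ⊕ K) (fun _ => F₁) fun _ => hF₁
  have hG₂ := union₂ (ULift.{u} ℕ ⊕ K) (fun _ => F₂) fun _ => hF₂
  refine ⟨fun d => cond d (.inl m₁) (.inr m₂), _,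
    ⟨(Σ _ : ULift.{u} ℕ ⊕ K, F₁.W), ⟨f₁ ⟨0⟩⟩, (Frame.disjointUnion fun _ => F₁).R,
      fun m a b => (Frame.disjointUnion fun _ => F₂).R m (e a) (e b), hG₁,
      iso₂ _ hG₂ _ ⟨e.symm, fun m a b => ?_⟩, rfl⟩,
    fun n => f₁ ⟨n⟩, fun i j h => by simpa using hf₁ h, fun i j hij => ?_⟩
  · exact iff_of_eq (congrArg₂ ((Frame.disjointUnion fun _ => F₂).R m)
      (e.apply_symm_apply a).symm (e.apply_symm_apply b).symm)
  · obtain ⟨i, rfl | rfl⟩ := Nat.even_or_odd' i <;> obtain ⟨j, rfl | rfl⟩ := Nat.even_or_odd' j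
    · simp at hij
    · simp only [Nat.bodd_mul, Nat.bodd_two, Bool.false_and, Bool.not_false, Bool.cond_true]
      change (Frame.disjointUnion fun _ => F₁).R m₁ (f₁ _) (f₁ _) ↔ _
      rw [f₁_even, f₁_odd, disjointUnion_const_rel]
      simp [hm₁, eq_comm]
    · simp only [Nat.bodd_succ, Nat.bodd_mul]
      change (Frame.disjointUnion fun _ => F₂).R m₂ (e (f₁ _)) (e (f₁ _)) ↔ _
      rw [he, he, f₂_odd]
      rcases j with _ | j
      · rw [Nat.mul_zero, f₂_zero, disjointUnion_const_rel]
        simp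
      · rw [f₂_even, disjointUnion_const_rel]
        simp only [Sum.inl.injEq, ULift.up.injEq, hm₂, and_true]
        omega
    · simp at hij

open CounterMachine Formula

/-! ### The model of an infinite run -/

section Run

variable {M : Type v} {F : Frame.{u} M}

/-- The model represents the configuration `c n` at the world `f n`, for all `n`, where the
elements of the domain are numbered by `e`. -/
structure IsRunModel (𝔐 : CDModel F) (e : 𝔐.Dom ≃ ℕ) (P : Program) (c : ℕ → Config)
    (f : ℕ → F.W) : Prop where
  hasLabel : ∀ s d l, HasLabel 𝔐 s d l ↔ ∃ n, s = f n ∧ d = !n.bodd ∧ l = (c n).1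
  mem_reg : ∀ n q b, b ∈ 𝔐.pred (f n) (4 * q) ↔ e b < (c n).2 q
  mem_numeral : ∀ s i b, b ∈ 𝔐.pred s (4 * i + 3) ↔ e b < i
  const_zero : ∀ n, e (𝔐.const (f n) 0) = (P (c n).1).elim 0 fun i => i.index (c n).2
  const_succ : ∀ s k, e (𝔐.const s (k + 1)) = k

/-- Registers are initial segments of `ℕ`. A label holds of all elements or of none, so it does not
depend on `c₀`; off the path there are no labels and `c₀` gets the dummy value 0. -/
theorem exists_isRunModel (P : Program) (c : ℕ → Config) {f : ℕ → F.W}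
    (hf : Function.Injective f) :
    ∃ (𝔐 : CDModel F) (e : 𝔐.Dom ≃ ℕ), IsRunModel 𝔐 e P c f := by
  let 𝔐 : CDModel F :=
    { Dom := ULift.{u} ℕ
      pred := fun s p => {b | (∃ i, p = 4 * i + 3 ∧ b.down < i) ∨ ∃ n, s = f n ∧
        ((∃ q, p = 4 * q ∧ b.down < (c n).2 q) ∨
          p = cond (!n.bodd) (4 * (c n).1 + 1) (4 * (c n).1 + 2))}
      const := fun s k => Nat.casesOn k
        (Function.extend f (fun n => ⟨(P (c n).1).elim 0 fun i => i.index (c n).2⟩)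
          (fun _ => ⟨0⟩) s) fun k => ⟨k⟩ }
  refine ⟨𝔐, Equiv.ulift, fun s d l => ?_, fun n q b => ?_, fun s i b => ?_, fun n => ?_,
    fun s k => rfl⟩
  · have h : ∀ n, (cond d (4 * l + 1) (4 * l + 2) = cond (!n.bodd) (4 * (c n).1 + 1)
        (4 * (c n).1 + 2)) ↔ d = !n.bodd ∧ l = (c n).1 := fun n => by
      cases d <;> cases n.bodd <;> simp <;> omega
    constructor
    · rintro (⟨i, hi, -⟩ | ⟨n, hn, ⟨q, hq, -⟩ | hl⟩)
      · cases d <;> simp at hi <;> omega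
      · cases d <;> simp at hq <;> omega
      · exact ⟨n, hn, (h n).1 hl⟩
    · rintro ⟨n, hn, hl⟩
      exact Or.inr ⟨n, hn, Or.inr ((h n).2 hl)⟩
  · constructor
    · rintro (⟨i, hi, -⟩ | ⟨k, hk, ⟨r, hr, hb⟩ | hl⟩)
      · omega
      · obtain rfl := hf hk
        obtain rfl : q = r := by omega
        exact hb
      · exfalso
        cases h : k.bodd <;> simp [h] at hl <;> omega
    · exact fun h => Or.inr ⟨n, rfl, Or.inl ⟨q, rfl, h⟩⟩
  · constructor
    · rintro (⟨j, hj, hb⟩ | ⟨k, -, ⟨r, hr, -⟩ | hl⟩)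
      · obtain rfl : i = j := by omega
        exact hb
      · omega
      · exfalso
        cases h : k.bodd <;> simp [h] at hl <;> omega
    · exact fun h => Or.inl ⟨i, rfl, h⟩
  · have h := hf.extend_apply
      (fun n => (⟨(P (c n).1).elim 0 fun i => i.index (c n).2⟩ : ULift.{u} ℕ)) (fun _ => ⟨0⟩) n
    exact congrArg ULift.down h

variable {𝔐 : CDModel F} {e : 𝔐.Dom ≃ ℕ} {P : Program} {c : ℕ → Config} {f : ℕ → F.W}

/-- A successor with the opposite label lies on the path at the opposite parity, so `hR` leaves only
`f (n + 1)`. -/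
theorem IsRunModel.sat_move (h𝔐 : IsRunModel 𝔐 e P c f) {m : Bool → M}
    (hR : ∀ i j, i.bodd ≠ j.bodd → (F.R (m !i.bodd) (f i) (f j) ↔ j = i + 1)) (n B : ℕ)
    (a : 𝔐.Dom) (θ : ℕ → Formula M)
    (h : ∀ q b, 𝔐.Sat (f n) b (θ q) ↔ e b < (c (n + 1)).2 q) :
    𝔐.Sat (f n) a (move m B (!n.bodd) (c (n + 1)).1 θ) := by
  refine (OneVarModal.sat_move _ _ _ _ _ _ _ _).2 ⟨⟨f (n + 1), (hR _ _ (by simp)).2 rfl,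
    (h𝔐.hasLabel _ _ _).2 ⟨n + 1, rfl, by simp, rfl⟩⟩, fun q _ s' hs hl => ?_⟩
  obtain ⟨j, rfl, hj, -⟩ := (h𝔐.hasLabel _ _ _).1 hl
  obtain rfl := (hR n j (by rintro e; simp [e] at hj)).1 hs
  ext b
  exact (h𝔐.mem_reg _ _ _).trans (h q b).symm

/-- Off the path every conjunct is vacuous. On it, `c₀` is the first element beyond the segment to
be extended, or the last one of the segment to be shortened. -/
theorem IsRunModel.models_program (h𝔐 : IsRunModel 𝔐 e P c f) {m : Bool → M}
    (hR : ∀ i j, i.bodd ≠ j.bodd → (F.R (m !i.bodd) (f i) (f j) ↔ j = i + 1)) (B : ℕ)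
    (hc : ∀ n, c (n + 1) = step P (c n)) (hP : ∀ n, P (c n).1 ≠ none) :
    𝔐.Models (program m B P) := by
  have key : ∀ n a, 𝔐.Sat (f n) a (effect m B (!n.bodd) (P (c n).1)) := by
    intro n a
    have hconst := h𝔐.const_zero n
    have hmem := h𝔐.mem_reg n
    have hmove := h𝔐.sat_move hR n B a
    have hn := hc n
    rcases hi : P (c n).1 with _ | ⟨r, t⟩ | ⟨r, t, u⟩
    · exact absurd hi (hP n)
    · simp only [step, hi, Option.elim_some, Instr.exec] at hn
      simp only [hi, Option.elim_some, Instr.index] at hconst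
      rw [hn] at hmove
      refine ⟨?_, hmove _ fun q b => ?_⟩
      · rw [sat_neg, sat_pred_const, hmem, hconst]
        exact lt_irrefl _
      · dsimp only
        rcases eq_or_ne q r with rfl | hqr
        · rw [if_pos rfl, sat_or, sat_reg, sat_eq_const, hmem, ← e.apply_eq_iff_eq, hconst,
            Function.update_self]
          omega
        · rw [if_neg hqr, sat_reg, hmem, Function.update_of_ne hqr]
    · simp only [step, hi, Option.elim_some, Instr.exec] at hn
      simp only [hi, Option.elim_some, Instr.index] at hconst
      have hex : 𝔐.Sat (f n) a (ex (reg r)) ↔ (c n).2 r ≠ 0 := by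
        simp only [sat_ex, sat_reg, hmem]
        exact ⟨fun ⟨b, hb⟩ => by omega, fun h => ⟨e.symm 0, by simpa using Nat.pos_of_ne_zero h⟩⟩
      refine ⟨?_, ?_⟩
      · rw [sat_imp, hex]
        intro h0
        rw [if_neg h0] at hn
        rw [hn] at hmove
        refine ⟨?_, hmove _ fun q b => ?_⟩
        · rw [sat_pred_const, hmem, hconst]
          omega
        · dsimp only
          rcases eq_or_ne q r with rfl | hqr
          · rw [if_pos rfl, sat_and, sat_neg, sat_reg, sat_eq_const, hmem,
              ← e.apply_eq_iff_eq, hconst, Function.update_self]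
            omega
          · rw [if_neg hqr, sat_reg, hmem, Function.update_of_ne hqr]
      · rw [sat_imp, sat_neg, hex, not_not]
        intro h0
        rw [if_pos h0] at hn
        rw [hn] at hmove
        exact hmove _ fun q b => by rw [sat_reg, hmem]
  intro s a
  simp only [program, sat_conj, sat_and, sat_imp, sat_lab, h𝔐.hasLabel]
  refine fun l _ => ⟨?_, ?_⟩ <;>
  · rintro ⟨n, rfl, hd, rfl⟩
    rw [hd]
    exact key n a

theorem IsRunModel.sat_input (h𝔐 : IsRunModel 𝔐 e P c f) (B n : ℕ) (hc : c 0 = start n)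
    (a : 𝔐.Dom) : 𝔐.Sat (f 0) a (input B n) := by
  have hnum : ∀ i, 𝔐.Sat (f 0) a (numeral i) := by
    intro i
    induction i with
    | zero =>
      rw [numeral, sat_neg, sat_ex]
      rintro ⟨b, hb⟩
      exact absurd ((h𝔐.mem_numeral (f 0) 0 b).1 hb) (by simp)
    | succ i ih =>
      refine ⟨ih, ?_, (sat_all _ _ _ _).2 fun b => ?_⟩
      · rw [sat_neg, sat_pred_const, h𝔐.mem_numeral, h𝔐.const_succ]
        exact lt_irrefl _
      · rw [sat_iff, sat_or, sat_pred_x, sat_pred_x, sat_eq_const, h𝔐.mem_numeral,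
          h𝔐.mem_numeral, ← e.apply_eq_iff_eq, h𝔐.const_succ]
        omega
  have hlab : HasLabel 𝔐 (f 0) true 0 :=
    (h𝔐.hasLabel _ _ _).2 ⟨0, rfl, rfl, by rw [hc]; rfl⟩
  refine ⟨⟨hlab, (sat_conj _ _ _ _ _).2 fun q _ => ?_⟩, hnum n, (sat_all _ _ _ _).2 fun b => ?_⟩
  · split_ifs with h0
    · exact hlab
    · rw [sat_neg, sat_ex]
      rintro ⟨b, hb⟩
      rw [sat_reg, h𝔐.mem_reg, hc] at hb
      simp [start, h0] at hb
  · rw [sat_iff, sat_reg, sat_pred_x, h𝔐.mem_reg, h𝔐.mem_numeral, hc]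
    simp [start]

end Run

/-- If the description of a program entails that the initial configuration is not represented
at any world, then the program stops. -/
theorem exists_halts_of_semanticGlobalConsequence {M₁ : Type v} {M₂ : Type w}
    {C₁ : Set (Frame.{u} M₁)} {C₂ : Set (Frame.{u} M₂)} (iso₂ : ClosedUnderIso C₂)
    (union₁ : ClosedUnderDisjointUnions C₁) (union₂ : ClosedUnderDisjointUnions C₂)
    (nontrivial₁ : ∃ F ∈ C₁, F.NonTrivial) (nontrivial₂ : ∃ F ∈ C₂, F.NonTrivial) :
    ∃ m : Bool → M₁ ⊕ M₂, ∀ (P : Program) (B n : ℕ),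
      SemanticGlobalConsequence (fusion C₁ C₂) (program m B P) (neg (input B n)) → Halts P n := by
  obtain ⟨m, F, hF, f, hf, hR⟩ :=
    exists_alternating_path iso₂ union₁ union₂ nontrivial₁ nontrivial₂
  refine ⟨m, fun P B n h => ?_⟩
  by_contra hn
  simp only [Halts, not_exists] at hn
  obtain ⟨𝔐, e, h𝔐⟩ := exists_isRunModel P (fun k => (step P)^[k] (start n)) hf
  exact h F hF 𝔐 (h𝔐.models_program hR B (fun k => Function.iterate_succ_apply' _ _ _) hn)
    (f 0) (e.symm 0) (h𝔐.sat_input B n rfl _)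

/-! ### Computability of the reduction -/

section Computability

variable {M : Type v} [Encodable M]

theorem primrec_code_neg {φ : ℕ → Formula M} (h : Primrec fun n => (φ n).code) :
    Primrec fun n => (neg (φ n)).code :=
  Primrec₂.natPair.comp (.const 2) h

theorem primrec_code_and {φ ψ : ℕ → Formula M} (h : Primrec fun n => (φ n).code)
    (h' : Primrec fun n => (ψ n).code) : Primrec fun n => (Formula.and (φ n) (ψ n)).code :=
  Primrec₂.natPair.comp (.const 3) (Primrec₂.natPair.comp h h')

theorem primrec_code_imp {φ ψ : ℕ → Formula M} (h : Primrec fun n => (φ n).code)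
    (h' : Primrec fun n => (ψ n).code) : Primrec fun n => ((φ n).imp (ψ n)).code :=
  primrec_code_neg (primrec_code_and h (primrec_code_neg h'))

theorem primrec_code_or {φ ψ : ℕ → Formula M} (h : Primrec fun n => (φ n).code)
    (h' : Primrec fun n => (ψ n).code) : Primrec fun n => ((φ n).or (ψ n)).code :=
  primrec_code_neg (primrec_code_and (primrec_code_neg h) (primrec_code_neg h'))

theorem primrec_code_iff {φ ψ : ℕ → Formula M} (h : Primrec fun n => (φ n).code)
    (h' : Primrec fun n => (ψ n).code) : Primrec fun n => ((φ n).iff (ψ n)).code :=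
  primrec_code_and (primrec_code_imp h h') (primrec_code_imp h' h)

theorem primrec_code_all {φ : ℕ → Formula M} (h : Primrec fun n => (φ n).code) :
    Primrec fun n => ((φ n).all).code :=
  primrec_code_neg (Primrec₂.natPair.comp (.const 4) (primrec_code_neg h))

theorem primrec_code_pred {p : ℕ → ℕ} {t : ℕ → Term} (hp : Primrec p)
    (ht : Primrec fun n => (t n).code) : Primrec fun n => (pred (M := M) (p n) (t n)).code :=
  Primrec₂.natPair.comp (.const 0) (Primrec₂.natPair.comp hp ht)

theorem primrec_code_eq {s t : ℕ → Term} (hs : Primrec fun n => (s n).code)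
    (ht : Primrec fun n => (t n).code) : Primrec fun n => (eq (M := M) (s n) (t n)).code :=
  Primrec₂.natPair.comp (.const 1) (Primrec₂.natPair.comp hs ht)

theorem primrec_code_numeral : Primrec fun n => (numeral (M := M) n).code := by
  have hp : Primrec fun n => 4 * n + 3 :=
    Primrec.nat_add.comp (Primrec.nat_mul.comp (.const 4) .id) (.const 3)
  have hx : Primrec fun _ : ℕ => Term.x.code := .const 0
  have ht : Primrec fun n => (Term.const (n + 1)).code := Primrec.succ.comp Primrec.succ
  have hstep : Primrec fun n => (increment (M := M) n).code :=
    primrec_code_and (primrec_code_neg (primrec_code_pred hp ht))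
      (primrec_code_all (primrec_code_iff (primrec_code_pred (hp.comp .succ) hx)
        (primrec_code_or (primrec_code_pred hp hx) (primrec_code_eq hx ht))))
  refine (Primrec.nat_rec₁ (numeral (M := M) 0).code (Primrec₂.natPair.comp₂ (.const 3)
    (Primrec₂.natPair.comp₂ .right (hstep.comp₂ .left)))).of_eq fun n => ?_
  induction n with
  | zero => rfl
  | succ n ih => exact congrArg (fun c => Nat.pair 3 (Nat.pair c (increment (M := M) n).code)) ih

/-- As `B` is fixed, only the numeral and the index of its last predicate vary with `n`. -/
theorem primrec_code_input (B : ℕ) : Primrec fun n => (input (M := M) B n).code := by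
  have hp : Primrec fun n => 4 * n + 3 :=
    Primrec.nat_add.comp (Primrec.nat_mul.comp (.const 4) .id) (.const 3)
  exact primrec_code_and (.const _) (primrec_code_and primrec_code_numeral
    (primrec_code_all (primrec_code_iff (.const _) (primrec_code_pred hp (.const 0)))))

/-- A relation between formulas is undecidable if an undecidable set reduces to it. -/
theorem not_decidableRelation {r : Formula M → Formula M → Prop} {p : ℕ → Prop}
    (hp : ¬ ComputablePred p) (φ : Formula M) {ψ : ℕ → Formula M}
    (hψ : Primrec fun n => (ψ n).code) (h : ∀ n, p n ↔ r φ (ψ n)) :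
    ¬ DecidableRelation r := by
  refine fun hr => hp (ComputablePred.computable_of_manyOneReducible
    ⟨fun n => (φ.code, (ψ n).code), ((Primrec.const _).pair hψ).to_comp, fun n => ?_⟩ hr)
  rw [h]
  refine ⟨fun h => ⟨_, _, rfl, h⟩, ?_⟩
  rintro ⟨φ', ψ', e, h'⟩
  rw [Prod.mk.injEq] at e
  rwa [Formula.code_injective e.1, Formula.code_injective e.2]

end Computability

end OneVarModal

theorem mainTheorem6 {M₁ : Type v} {M₂ : Type w} [Finite M₁] [Finite M₂]
    [Encodable M₁] [Encodable M₂]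
    (C₁ : Set (OneVarModal.Frame.{u} M₁)) (C₂ : Set (OneVarModal.Frame.{u} M₂))
    (iso₁ : OneVarModal.ClosedUnderIso C₁) (iso₂ : OneVarModal.ClosedUnderIso C₂)
    (union₁ : OneVarModal.ClosedUnderDisjointUnions C₁)
    (union₂ : OneVarModal.ClosedUnderDisjointUnions C₂)
    (nontrivial₁ : ∃ F ∈ C₁, F.NonTrivial) (nontrivial₂ : ∃ F ∈ C₂, F.NonTrivial) :
    ¬ OneVarModal.DecidableRelation
        (OneVarModal.GlobalConsequence
          (OneVarModal.LogCDEq (OneVarModal.fusion C₁ C₂))) ∧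
    ¬ OneVarModal.DecidableRelation
        (OneVarModal.SemanticGlobalConsequence (OneVarModal.fusion C₁ C₂)) := by
  obtain ⟨P, ⟨N, hN⟩, hP⟩ := CounterMachine.exists_undecidable_program
  obtain ⟨B, hB⟩ := CounterMachine.exists_boundedBy hN
  obtain ⟨m, hm⟩ := OneVarModal.exists_halts_of_semanticGlobalConsequence iso₂ union₁ union₂
    nontrivial₁ nontrivial₂
  have hcode := OneVarModal.primrec_code_neg (M := M₁ ⊕ M₂) (OneVarModal.primrec_code_input B)
  exact ⟨OneVarModal.not_decidableRelation hP (.program m B P) hcode fun n =>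
      ⟨OneVarModal.globalConsequence_of_halts hB, fun h => hm P B n h.semantic⟩,
    OneVarModal.not_decidableRelation hP (.program m B P) hcode fun n =>
      ⟨fun h => (OneVarModal.globalConsequence_of_halts hB h).semantic, hm P B n⟩⟩
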